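/- Let $H$ be a finite undirected graph without multiple edges, possibly with loops. For a simple graph $G$, an $H$-colouring of $G$ is a map $f:V(G)\to V(H)$ such that $f(u)f(v)\in E(H)$ whenever $uv\in E(G)$; $\hom(G,H)$ is the number of $H$-colourings of $G$. Let $P_n$ be the path on $n$ vertices. Let $H^1,\dots,H^k$ be the orbits of the automorphism group of $H$ on $V(H)$, in some order; for $1\le i,j\le k$ let $m_{i,j}$ be the number of neighbours in $H^j$ of a vertex of $H^i$ (which does not depend on the choice of the vertex). For a graph $G$ with a distinguished vertex $v$, let $\hom^{v\to i}(G,H)$ be the number of $H$-colourings of $G$ that send $v$ to a fixed vertex of $H^i$ (which does not depend on the choice of the fixed vertex). Suppose that the orbits can be ordered in such a way that $$\sum_{j=c}^k m_{i,j}\le\sum_{j=c}^k m_{i+1,j}\qquad\text{for all }1\le c\le k\text{ and }1\le i\le k-1.$$ Suppose also that for each $t\ge 2$ there are orbits $H^{a(t)}$ and $H^{b(t)}$ such that 1. at least one $H$-colouring of $P_t$ sends one endvertex of $P_t$ to a vertex of $H^{a(t)}$ and the other endvertex to a vertex of $H^{b(t)}$, and 2. for all $s\ge 2$, $\hom^{v\to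 b(t)}(P_s,H)>\hom^{v\to a(t)}(P_s,H)$, where $v$ is an endvertex of $P_s$. Then $H$ is strongly Hoffman-London: for every $n\ge 1$ and every tree $T$ on $n$ vertices that is not isomorphic to $P_n$, $\hom(P_n,H)<\hom(T,H)$. -/

import Mathlib

universe u v

/-- A target graph: an undirected graph without multiple edges, in which loops are allowed. -/
structure TargetGraph (W : Type u) where
  /-- The adjacency relation; `Adj w w` means that there is a loop at `w`. -/
  Adj : W → W → Prop
  symm : ∀ x y : W, Adj x y → Adj y x

namespace TargetGraph

/-- The `H`-colourings of a simple graph `G`: the adjacency preserving maps from the vertices of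
`G` to the vertices of `H`. -/
abbrev Coloring {W : Type u} (H : TargetGraph W) {V : Type v} (G : SimpleGraph V) : Type (max v u) :=
  G.Adj →r H.Adj

/-- `hom(G, H)`, the number of `H`-colourings of `G`. -/
noncomputable def homCount {W : Type u} (H : TargetGraph W) {V : Type v} (G : SimpleGraph V) : ℕ :=
  Nat.card (H.Coloring G)

/-- Automorphisms of `H`: bijections of the vertex set that preserve adjacency and
non-adjacency. -/
abbrev Aut {W : Type u} (H : TargetGraph W) : Type u := H.Adj ≃r H.Adj

/-- Automorphic similarity: some automorphism of `H` sends `x` to `y`. -/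
def simSetoid {W : Type u} (H : TargetGraph W) : Setoid W where
  r x y := ∃ φ : H.Aut, φ x = y
  iseqv :=
    { refl := fun x => ⟨RelIso.refl H.Adj, rfl⟩
      symm := by
        rintro x y ⟨φ, rfl⟩
        exact ⟨φ.symm, φ.symm_apply_apply x⟩
      trans := by
        rintro x y z ⟨φ, rfl⟩ ⟨ψ, rfl⟩
        exact ⟨φ.trans ψ, rfl⟩ }

/-- The automorphic similarity classes (automorphism orbits) of `H`. -/
abbrev SimClass {W : Type u} (H : TargetGraph W) : Type u := Quotient H.simSetoid

/-- The automorphic similarity class of a vertex of `H`. -/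
def simClass {W : Type u} (H : TargetGraph W) (w : W) : H.SimClass := Quotient.mk H.simSetoid w

theorem simClass_aut {W : Type u} (H : TargetGraph W) (φ : H.Aut) (w : W) :
    H.simClass (φ w) = H.simClass w :=
  (Quotient.sound (s := H.simSetoid) ⟨φ, rfl⟩ : H.simClass w = H.simClass (φ w)).symm

/-- The number of neighbours that the vertex `x` has in the similarity class `j`. -/
noncomputable def nbrCount {W : Type u} (H : TargetGraph W) (j : H.SimClass) (x : W) : ℕ :=
  Nat.card {y : W // H.Adj x y ∧ H.simClass y = j}

theorem nbrCount_aut {W : Type u} (H : TargetGraph W) (j : H.SimClass) (φ : H.Aut) (x : W) :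
    H.nbrCount j x = H.nbrCount j (φ x) :=
  Nat.card_congr (φ.toEquiv.subtypeEquiv fun y => by
    change H.Adj x y ∧ H.simClass y = j ↔ H.Adj (φ x) (φ y) ∧ H.simClass (φ y) = j
    rw [H.simClass_aut φ y, φ.map_rel_iff])

/-- The number of neighbours that any vertex of the similarity class `i` has in the similarity
class `j`. -/
noncomputable def classNbrCount {W : Type u} (H : TargetGraph W) (i j : H.SimClass) : ℕ :=
  Quotient.lift (s := H.simSetoid) (fun x => H.nbrCount j x)
    (by rintro x y ⟨φ, rfl⟩; exact H.nbrCount_aut j φ x) i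

/-- The automorphic similarity matrix of `H`, relative to an ordering `H^1, …, H^k` of the
automorphic similarity classes. -/
noncomputable def simMatrix {W : Type u} (H : TargetGraph W) {k : ℕ} (e : Fin k ≃ H.SimClass) :
    Matrix (Fin k) (Fin k) ℕ :=
  Matrix.of fun i j => H.classNbrCount (e i) (e j)

/-- The number of `H`-colourings of `G` that send the vertex `v` of `G` to the vertex `x`. -/
noncomputable def homCountAt {W : Type u} (H : TargetGraph W) {V : Type v} (G : SimpleGraph V)
    (v : V) (x : W) : ℕ :=
  Nat.card {f : H.Coloring G // f v = x}

theorem homCountAt_aut {W : Type u} (H : TargetGraph W) {V : Type v} (G : SimpleGraph V)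
    (v : V) (φ : H.Aut) (x : W) : H.homCountAt G v x = H.homCountAt G v (φ x) :=
  Nat.card_congr
    { toFun := fun f => ⟨φ.toRelEmbedding.toRelHom.comp f.1, congrArg φ f.2⟩
      invFun := fun f => ⟨φ.symm.toRelEmbedding.toRelHom.comp f.1, by
        change φ.symm (f.1 v) = x
        rw [f.2, φ.symm_apply_apply]⟩
      left_inv := fun f => Subtype.ext (RelHom.ext fun z => φ.symm_apply_apply (f.1 z))
      right_inv := fun f => Subtype.ext (RelHom.ext fun z => φ.apply_symm_apply (f.1 z)) }

/-- The number of `H`-colourings of `G` in which the vertex `v` of `G` is sent to an arbitrary but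
fixed representative of the similarity class `i`. -/
noncomputable def homCountClass {W : Type u} (H : TargetGraph W) {V : Type v} (G : SimpleGraph V)
    (v : V) (i : H.SimClass) : ℕ :=
  Quotient.lift (s := H.simSetoid) (fun x => H.homCountAt G v x)
    (by rintro x y ⟨φ, rfl⟩; exact H.homCountAt_aut G v φ x) i

/-- `H` is strongly Hoffman-London: for all `n ≥ 1`, among the trees on `n` vertices, the path is
(up to isomorphism) the unique minimizer of the number of `H`-colourings. -/
def StronglyHoffmanLondon {W : Type u} (H : TargetGraph W) : Prop :=
  ∀ n : ℕ, 1 ≤ n → ∀ T : SimpleGraph (Fin n), T.IsTree →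
    ¬ Nonempty (T ≃g SimpleGraph.pathGraph n) →
      H.homCount (SimpleGraph.pathGraph n) < H.homCount T

end TargetGraph

/-- The increasing columns property: the sum of any terminal segment of columns is
non-decreasing. -/
def HasIncreasingColumns {k : ℕ} (M : Matrix (Fin k) (Fin k) ℕ) : Prop :=
  ∀ c i i' : Fin k, (i : ℕ) + 1 = (i' : ℕ) →
    ∑ j ∈ Finset.Ici c, M i j ≤ ∑ j ∈ Finset.Ici c, M i' j

/-- The first vertex of the path on `t ≥ 2` vertices. -/
def pathFirst (t : ℕ) (ht : 2 ≤ t) : Fin t := ⟨0, by omega⟩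

/-- The last vertex of the path on `t ≥ 2` vertices. -/
def pathLast (t : ℕ) (ht : 2 ≤ t) : Fin t := ⟨t - 1, by omega⟩

/-!
Let `A` be the adjacency matrix of `H` over `ℕ`. Rank the vertices of `H` by the position of their
orbit; a weight `W → ℕ` is *rank monotone* if it is non-decreasing in the rank. The increasing
columns property says that `A` preserves rank monotone weights (`RankMonotone.mulVec`), so the number
of colourings of a rooted tree, as a function of the colour of the root, is rank monotone.

If two branches with weights `f` and `g` sit at the two ends of a connecting path whose kernel is the
symmetric matrix `M = A ^ m`, moving `g` next to `f` changes the number of colourings by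
`½ ∑ M x y (f x - f y) (g x - g y)`. For rank monotone `f` and `g` this is non-negative
(`dotProduct_mulVec_le`), and it is positive as soon as some `x, y` with `M x y > 0` are separated
by both weights (`dotProduct_mulVec_lt`). By induction, cutting an edge at the root, a rooted tree has
at least as many colourings as the path of the same size rooted at an endvertex, against any rank
monotone weight at the root (`TargetGraph.walkCount_dotProduct_le_homCountAt`).

A tree that is not a path has a vertex with at least three neighbours
(`SimpleGraph.IsTree.exists_three_le_ncard_neighborSet`). Replacing the branches there by paths
leaves a spider with three legs, and unfolding it into a path is a strict decrease, because the
orbits `a` and `b` are joined by a colouring of the connecting path and are separated by the weights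
of the other two legs (`TargetGraph.homCount_pathGraph_lt`).
-/

/-! ### Monotone weights and symmetric kernels -/

/-- The weight `f` is non-decreasing along the rank function `r`. In particular `f` is constant on
the fibres of `r`; with `r` the position of the orbit, this makes `f` a function of the orbit. -/
def RankMonotone {W ι : Type*} [Preorder ι] (r : W → ι) (f : W → ℕ) : Prop :=
  ∀ x y, r x ≤ r y → f x ≤ f y

namespace RankMonotone

variable {W ι : Type*}

theorem mul [Preorder ι] {r : W → ι} {f g : W → ℕ} (hf : RankMonotone r f)
    (hg : RankMonotone r g) : RankMonotone r (f * g) :=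
  fun x y h => Nat.mul_le_mul (hf x y h) (hg x y h)

theorem one [Preorder ι] (r : W → ι) : RankMonotone r 1 := fun _ _ _ => le_rfl

theorem cross_le [LinearOrder ι] {r : W → ι} {f g : W → ℕ} (hf : RankMonotone r f)
    (hg : RankMonotone r g) (x y : W) : f x * g y + f y * g x ≤ f x * g x + f y * g y := by
  rcases le_total (r x) (r y) with h | h
  · linarith [mul_add_mul_le_mul_add_mul (hf x y h) (hg x y h)]
  · linarith [mul_add_mul_le_mul_add_mul (hf y x h) (hg y x h)]

/-- A layer cake argument: a weight is the sum of the indicators of its superlevel sets, and these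
are terminal segments of the ranking, so it suffices that `M` has non-decreasing row sums over
terminal segments. -/
theorem mulVec [Fintype W] [LinearOrder ι] {r : W → ι} {M : Matrix W W ℕ}
    (hM : ∀ (c : ι) (x y : W), r x ≤ r y →
      ∑ z with c ≤ r z, M x z ≤ ∑ z with c ≤ r z, M y z)
    {f : W → ℕ} (hf : RankMonotone r f) : RankMonotone r (M.mulVec f) := by
  intro x y hxy
  obtain ⟨N, hN⟩ : ∃ N, ∀ z, f z ≤ N := ⟨∑ z, f z, fun z =>
    Finset.single_le_sum (fun _ _ => Nat.zero_le _) (Finset.mem_univ z)⟩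
  have layer : ∀ v : W, M.mulVec f v = ∑ m ∈ Finset.range N, ∑ z with m < f z, M v z := by
    intro v
    simp only [Matrix.mulVec, dotProduct, Finset.sum_filter]
    rw [Finset.sum_comm]
    refine Finset.sum_congr rfl fun z _ => ?_
    rw [← Finset.sum_filter, Finset.sum_const, smul_eq_mul, mul_comm]
    congr 1
    have : (Finset.range N).filter (fun m => m < f z) = Finset.range (f z) := by
      ext m
      have := hN z
      simp only [Finset.mem_filter, Finset.mem_range]
      omega
    rw [this, Finset.card_range]
  rw [layer, layer]
  refine Finset.sum_le_sum fun m _ => ?_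
  rcases (Finset.univ.filter fun z => m < f z).eq_empty_or_nonempty with h | h
  · simp [h]
  · obtain ⟨z₀, hz₀, hmin⟩ := Finset.exists_min_image _ r h
    have : (Finset.univ.filter fun z => m < f z) = Finset.univ.filter fun z => r z₀ ≤ r z := by
      ext z
      simp only [Finset.mem_filter, Finset.mem_univ, true_and] at hz₀ hmin ⊢
      exact ⟨hmin z, fun h => hz₀.trans_le (hf _ _ h)⟩
    rw [this]
    exact hM _ x y hxy

end RankMonotone

section Merge

open Matrix

variable {W ι : Type*} [Fintype W] [LinearOrder ι] {r : W → ι}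

theorem two_mul_dotProduct_mul_mulVec_one {M : Matrix W W ℕ} (hM : M.IsSymm) (f g : W → ℕ) :
    2 * (f ⬝ᵥ (g * M *ᵥ 1)) = ∑ x, ∑ y, M x y * (f x * g x + f y * g y) := by
  have h : f ⬝ᵥ (g * M *ᵥ 1) = ∑ x, ∑ y, M x y * (f x * g x) := by
    simp only [dotProduct, mulVec, Pi.mul_apply, Pi.one_apply, mul_one, Finset.mul_sum]
    exact Finset.sum_congr rfl fun x _ => Finset.sum_congr rfl fun y _ => by ring
  have h' : ∑ x, ∑ y, M x y * (f x * g x) = ∑ x, ∑ y, M x y * (f y * g y) := by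
    rw [Finset.sum_comm]
    exact Finset.sum_congr rfl fun x _ => Finset.sum_congr rfl fun y _ => by rw [hM.apply]
  simp only [mul_add, Finset.sum_add_distrib]
  rw [← h', ← h]
  ring

theorem two_mul_dotProduct_mulVec {M : Matrix W W ℕ} (hM : M.IsSymm) (f g : W → ℕ) :
    2 * (f ⬝ᵥ (M *ᵥ g)) = ∑ x, ∑ y, M x y * (f x * g y + f y * g x) := by
  have h : f ⬝ᵥ (M *ᵥ g) = ∑ x, ∑ y, M x y * (f x * g y) := by
    simp only [dotProduct, mulVec, Finset.mul_sum]
    exact Finset.sum_congr rfl fun x _ => Finset.sum_congr rfl fun y _ => by ring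
  have h' : ∑ x, ∑ y, M x y * (f x * g y) = ∑ x, ∑ y, M x y * (f y * g x) := by
    rw [Finset.sum_comm]
    exact Finset.sum_congr rfl fun x _ => Finset.sum_congr rfl fun y _ => by rw [hM.apply]
  simp only [mul_add, Finset.sum_add_distrib]
  rw [← h', ← h]
  ring

/-- The effect of moving the branch with weight `g` from one end of a connecting path, with kernel
`M`, to the other end, where the branch with weight `f` stays. -/
theorem dotProduct_mulVec_le {M : Matrix W W ℕ} (hM : M.IsSymm) {f g : W → ℕ}
    (hf : RankMonotone r f) (hg : RankMonotone r g) :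
    f ⬝ᵥ (M *ᵥ g) ≤ f ⬝ᵥ (g * M *ᵥ 1) := by
  refine le_of_mul_le_mul_left ?_ two_pos
  rw [two_mul_dotProduct_mul_mulVec_one hM, two_mul_dotProduct_mulVec hM]
  exact Finset.sum_le_sum fun x _ => Finset.sum_le_sum fun y _ =>
    Nat.mul_le_mul_left _ (hf.cross_le hg x y)

theorem dotProduct_mulVec_lt {M : Matrix W W ℕ} (hM : M.IsSymm) {f g : W → ℕ}
    (hf : RankMonotone r f) (hg : RankMonotone r g) {x y : W} (hxy : 0 < M x y)
    (hfx : f x < f y) (hgx : g x < g y) :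
    f ⬝ᵥ (M *ᵥ g) < f ⬝ᵥ (g * M *ᵥ 1) := by
  refine lt_of_mul_lt_mul_left ?_ (Nat.zero_le 2)
  rw [two_mul_dotProduct_mul_mulVec_one hM, two_mul_dotProduct_mulVec hM]
  have hle : ∀ x y, M x y * (f x * g y + f y * g x) ≤ M x y * (f x * g x + f y * g y) :=
    fun x y => Nat.mul_le_mul_left _ (hf.cross_le hg x y)
  refine Finset.sum_lt_sum (fun x _ => Finset.sum_le_sum fun y _ => hle x y)
    ⟨x, Finset.mem_univ x, Finset.sum_lt_sum (fun y _ => hle x y) ⟨y, Finset.mem_univ y, ?_⟩⟩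
  exact Nat.mul_lt_mul_of_pos_left (mul_add_mul_lt_mul_add_mul hfx hgx) hxy

end Merge

namespace TargetGraph

open Matrix

variable {W : Type u} (H : TargetGraph W)

/-! ### The adjacency matrix of the target graph -/

open Classical in
/-- The adjacency matrix of `H`, with natural number entries. -/
noncomputable def adjMat : Matrix W W ℕ := Matrix.of fun x y => if H.Adj x y then 1 else 0

theorem adjMat_isSymm : H.adjMat.IsSymm := by
  refine Matrix.IsSymm.ext fun x y => ?_
  have : H.Adj y x ↔ H.Adj x y := ⟨H.symm y x, H.symm x y⟩
  classical exact if_congr this rfl rfl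

theorem adjMat_eq_one {x y : W} (h : H.Adj x y) : H.adjMat x y = 1 := by simp [adjMat, h]

/-- The number of walks of length `n` in `H` that start at the given vertex; equivalently, the
number of colourings of the path on `n + 1` vertices with prescribed colour of an endvertex. -/
noncomputable def walkCount [Fintype W] [DecidableEq W] (n : ℕ) : W → ℕ := H.adjMat ^ n *ᵥ 1

variable [Fintype W]

theorem dotProduct_adjMat_mulVec (f g : W → ℕ) :
    f ⬝ᵥ (H.adjMat *ᵥ g) = (H.adjMat *ᵥ f) ⬝ᵥ g := by
  rw [dotProduct_mulVec, ← mulVec_transpose, H.adjMat_isSymm.eq]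

/-- The increasing columns property is the row sum condition of `RankMonotone.mulVec`. -/
theorem rankMonotone_adjMat_mulVec {k : ℕ} {e : Fin k ≃ H.SimClass}
    (he : HasIncreasingColumns (H.simMatrix e)) {f : W → ℕ}
    (hf : RankMonotone (fun x => e.symm (H.simClass x)) f) :
    RankMonotone (fun x => e.symm (H.simClass x)) (H.adjMat *ᵥ f) := by
  classical
  refine RankMonotone.mulVec (fun c x y hxy => ?_) hf
  have rowSum : ∀ x, ∑ z with c ≤ e.symm (H.simClass z), H.adjMat x z =
      ∑ j ∈ Finset.Ici c, H.simMatrix e (e.symm (H.simClass x)) j := by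
    intro x
    rw [← Finset.sum_fiberwise_of_maps_to (t := Finset.Ici c)
      (g := fun z => e.symm (H.simClass z)) (by simp)]
    refine Finset.sum_congr rfl fun j hj => ?_
    have : H.simMatrix e (e.symm (H.simClass x)) j = H.nbrCount (e j) x := by
      simp only [simMatrix, of_apply, Equiv.apply_symm_apply]
      rfl
    rw [this, nbrCount, Nat.card_eq_fintype_card, Fintype.card_subtype]
    simp only [adjMat, of_apply, Finset.sum_boole, Finset.filter_filter, Nat.cast_id]
    congr 1
    ext z
    simp only [Finset.mem_filter, Finset.mem_univ, true_and, Equiv.symm_apply_eq]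
    constructor
    · rintro ⟨⟨-, h⟩, h'⟩
      exact ⟨h', h⟩
    · rintro ⟨h, h'⟩
      refine ⟨⟨?_, h'⟩, h⟩
      rw [h', e.symm_apply_apply]
      exact Finset.mem_Ici.mp hj
  rw [rowSum, rowSum]
  have step : ∀ (d : ℕ) (i i' : Fin k), (i : ℕ) + d = i' →
      ∑ j ∈ Finset.Ici c, H.simMatrix e i j ≤ ∑ j ∈ Finset.Ici c, H.simMatrix e i' j := by
    intro d
    induction d with
    | zero =>
      intro i i' h
      rw [Fin.ext (by simpa using h : (i : ℕ) = i')]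
    | succ d ih =>
      intro i i' h
      have := i'.isLt
      exact (ih i ⟨i + d, by omega⟩ rfl).trans (he c _ i' (by simpa [add_assoc] using h))
  exact step _ _ _ (Nat.add_sub_cancel' (Fin.le_def.mp hxy))

section Walks

variable [DecidableEq W]

theorem walkCount_zero : H.walkCount 0 = 1 := by simp [walkCount]

theorem walkCount_add (m n : ℕ) : H.walkCount (m + n) = H.adjMat ^ m *ᵥ H.walkCount n := by
  simp [walkCount, pow_add]

theorem walkCount_succ (n : ℕ) : H.walkCount (n + 1) = H.adjMat *ᵥ H.walkCount n := by
  rw [add_comm, walkCount_add, pow_one]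

variable {H} {ι : Type*} [LinearOrder ι] {r : W → ι}

theorem rankMonotone_walkCount
    (hr : ∀ f, RankMonotone r f → RankMonotone r (H.adjMat *ᵥ f)) (n : ℕ) :
    RankMonotone r (H.walkCount n) := by
  induction n with
  | zero => simpa [walkCount_zero] using RankMonotone.one r
  | succ n ih => simpa [walkCount_succ] using hr _ ih

/-- Two legs of lengths `m` and `n` at the root weigh at least as much as a single leg of
length `m + n`. -/
theorem dotProduct_walkCount_add_le
    (hr : ∀ f, RankMonotone r f → RankMonotone r (H.adjMat *ᵥ f)) {f : W → ℕ}
    (hf : RankMonotone r f) (m n : ℕ) :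
    f ⬝ᵥ H.walkCount (m + n) ≤ f ⬝ᵥ (H.walkCount n * H.walkCount m) := by
  rw [walkCount_add]
  exact dotProduct_mulVec_le (H.adjMat_isSymm.pow m) hf (rankMonotone_walkCount hr n)

end Walks

end TargetGraph

/-! ### Joining two rooted graphs by an edge -/

namespace SimpleGraph

/-- The disjoint union of `G₁` and `G₂` together with one edge, joining `v₁` to `v₂`. -/
def edgeJoin {V₁ V₂ : Type*} (G₁ : SimpleGraph V₁) (v₁ : V₁) (G₂ : SimpleGraph V₂) (v₂ : V₂) :
    SimpleGraph (V₁ ⊕ V₂) where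
  Adj
    | .inl a, .inl b => G₁.Adj a b
    | .inr a, .inr b => G₂.Adj a b
    | .inl a, .inr b => a = v₁ ∧ b = v₂
    | .inr b, .inl a => a = v₁ ∧ b = v₂
  symm := ⟨by
    rintro (a | a) (b | b) h
    exacts [G₁.adj_symm h, h, h, G₂.adj_symm h]⟩
  loopless := ⟨by
    rintro (a | a) h
    exacts [G₁.loopless.irrefl a h, G₂.loopless.irrefl a h]⟩

section EdgeJoin

variable {V₁ V₂ : Type*} {G₁ : SimpleGraph V₁} {v₁ : V₁} {G₂ : SimpleGraph V₂} {v₂ : V₂}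

@[simp] theorem edgeJoin_adj_inl_inl {a b : V₁} :
    (edgeJoin G₁ v₁ G₂ v₂).Adj (.inl a) (.inl b) ↔ G₁.Adj a b := Iff.rfl

@[simp] theorem edgeJoin_adj_inr_inr {a b : V₂} :
    (edgeJoin G₁ v₁ G₂ v₂).Adj (.inr a) (.inr b) ↔ G₂.Adj a b := Iff.rfl

@[simp] theorem edgeJoin_adj_inl_inr {a : V₁} {b : V₂} :
    (edgeJoin G₁ v₁ G₂ v₂).Adj (.inl a) (.inr b) ↔ a = v₁ ∧ b = v₂ := Iff.rfl

@[simp] theorem edgeJoin_adj_inr_inl {a : V₁} {b : V₂} :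
    (edgeJoin G₁ v₁ G₂ v₂).Adj (.inr b) (.inl a) ↔ a = v₁ ∧ b = v₂ := Iff.rfl

theorem neighborSet_edgeJoin_inl :
    (edgeJoin G₁ v₁ G₂ v₂).neighborSet (.inl v₁) =
      insert (.inr v₂) (Sum.inl '' G₁.neighborSet v₁) := by
  ext (a | a) <;> simp

theorem neighborSet_edgeJoin_inr :
    (edgeJoin G₁ v₁ G₂ v₂).neighborSet (.inr v₂) =
      insert (.inl v₁) (Sum.inr '' G₂.neighborSet v₂) := by
  ext (a | a) <;> simp

theorem ncard_neighborSet_edgeJoin_inl [Finite V₁] :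
    ((edgeJoin G₁ v₁ G₂ v₂).neighborSet (.inl v₁)).ncard = (G₁.neighborSet v₁).ncard + 1 := by
  rw [neighborSet_edgeJoin_inl, Set.ncard_insert_of_notMem (by simp) (Set.toFinite _),
    Set.ncard_image_of_injective _ Sum.inl_injective]

theorem ncard_neighborSet_edgeJoin_inr [Finite V₂] :
    ((edgeJoin G₁ v₁ G₂ v₂).neighborSet (.inr v₂)).ncard = (G₂.neighborSet v₂).ncard + 1 := by
  rw [neighborSet_edgeJoin_inr, Set.ncard_insert_of_notMem (by simp) (Set.toFinite _),
    Set.ncard_image_of_injective _ Sum.inr_injective]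

theorem ncard_neighborSet_le_edgeJoin_inr [Finite V₁] [Finite V₂] (a : V₂) :
    (G₂.neighborSet a).ncard ≤ ((edgeJoin G₁ v₁ G₂ v₂).neighborSet (.inr a)).ncard := by
  rw [← Set.ncard_image_of_injective _ (Sum.inr_injective (α := V₁))]
  refine Set.ncard_le_ncard ?_ (Set.toFinite _)
  rintro _ ⟨b, hb, rfl⟩
  exact hb

end EdgeJoin

theorem Iso.ncard_neighborSet {V V' : Type*} {G : SimpleGraph V} {G' : SimpleGraph V'}
    (φ : G ≃g G') (v : V) : (G'.neighborSet (φ v)).ncard = (G.neighborSet v).ncard :=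
  (Nat.card_congr (φ.mapNeighborSet v)).symm

/-- Deleting an edge of a tree at the root `v` exhibits the tree as an edge join of two trees. -/
theorem IsTree.exists_iso_edgeJoin {V : Type v} {T : SimpleGraph V} (hT : T.IsTree) {v u : V}
    (hvu : T.Adj v u) :
    ∃ (V₁ V₂ : Type v) (T₁ : SimpleGraph V₁) (T₂ : SimpleGraph V₂) (v₁ : V₁) (v₂ : V₂)
      (φ : edgeJoin T₁ v₁ T₂ v₂ ≃g T), T₁.IsTree ∧ T₂.IsTree ∧ φ (.inl v₁) = v := by
  classical
  set D := T.deleteEdges {s(v, u)} with hD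
  have hbridge : ¬ D.Reachable v u :=
    isAcyclic_iff_forall_adj_isBridge.mp hT.isAcyclic hvu
  have hadj : ∀ {a b}, T.Adj a b → D.Adj a b ∨ (a = v ∧ b = u) ∨ (a = u ∧ b = v) := by
    intro a b h
    by_cases he : s(a, b) = s(v, u)
    · right
      simpa using he
    · left
      rw [hD, deleteEdges_adj]
      exact ⟨h, he⟩
  have hcover : ∀ w, D.Reachable v w ∨ D.Reachable u w := by
    intro w
    have := (reachable_iff_reflTransGen v w).mp (hT.connected v w)
    induction this with
    | refl => exact Or.inl (Reachable.refl v)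
    | tail _ hab ih =>
      rcases hadj hab with h | ⟨-, rfl⟩ | ⟨-, rfl⟩
      · exact ih.imp (fun i => i.trans h.reachable) fun i => i.trans h.reachable
      · exact Or.inr (Reachable.refl _)
      · exact Or.inl (Reachable.refl _)
  let c : D.ConnectedComponent := D.connectedComponentMk v
  have hmem : ∀ {w}, w ∈ c.supp ↔ D.Reachable v w := fun {w} => by
    rw [ConnectedComponent.mem_supp_iff, ConnectedComponent.eq, reachable_comm]
  have hcompl : c.suppᶜ = (D.connectedComponentMk u).supp := by
    ext w
    rw [Set.mem_compl_iff, hmem, ConnectedComponent.mem_supp_iff, ConnectedComponent.eq,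
      reachable_comm (u := w)]
    exact ⟨fun h => (hcover w).resolve_left h, fun h h' => hbridge (h'.trans h.symm)⟩
  have hv : v ∈ c.supp := hmem.mpr (Reachable.refl v)
  have hu : u ∈ c.suppᶜ := fun h => hbridge (hmem.mp h)
  have hle : ∀ s : Set V, D.induce s ≤ T.induce s := fun s => comap_monotone _ (deleteEdges_le _)
  have hcross : ∀ {a b}, a ∈ c.supp → b ∈ c.suppᶜ → (T.Adj a b ↔ a = v ∧ b = u) := by
    intro a b ha hb
    refine ⟨fun h => ?_, by rintro ⟨rfl, rfl⟩; exact hvu⟩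
    rcases hadj h with h | h | ⟨-, rfl⟩
    · exact absurd (hmem.mpr ((hmem.mp ha).trans h.reachable)) hb
    · exact h
    · exact absurd hv hb
  refine ⟨c.supp, (c.suppᶜ : Set V), T.induce c.supp, T.induce c.suppᶜ, ⟨v, hv⟩, ⟨u, hu⟩,
    ⟨Equiv.Set.sumCompl c.supp, ?_⟩, ⟨?_, hT.isAcyclic.induce _⟩, ⟨?_, hT.isAcyclic.induce _⟩, rfl⟩
  · rintro (⟨a, ha⟩ | ⟨a, ha⟩) (⟨b, hb⟩ | ⟨b, hb⟩)
    · simp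
    · simpa using hcross ha hb
    · simpa [adj_comm] using hcross hb ha
    · simp
  · exact (ConnectedComponent.connected_toSimpleGraph c).mono (hle _)
  · refine Connected.mono (hle _) ?_
    rw [hcompl]
    exact ConnectedComponent.connected_toSimpleGraph _

/-! ### Paths as edge joins, and trees of maximum degree two -/

/-- Prepending a vertex, the root of a one-vertex graph, to a path. -/
def pathGraphSuccIso {V : Type*} [Unique V] (G : SimpleGraph V) (n : ℕ) :
    edgeJoin G default (pathGraph (n + 1)) 0 ≃g pathGraph (n + 2) where
  toFun := Sum.elim (fun _ => 0) Fin.succ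
  invFun := Fin.cases (Sum.inl default) Sum.inr
  left_inv := by
    rintro (a | a)
    · simp [Unique.eq_default a]
    · simp
  right_inv i := by
    refine Fin.cases ?_ (fun i => ?_) i <;> simp
  map_rel_iff' := by
    rintro (a | a) (b | b)
    · simp [Subsingleton.elim a b]
    · change (pathGraph (n + 2)).Adj 0 b.succ ↔ a = default ∧ b = 0
      rw [pathGraph_adj, eq_true (Subsingleton.elim a default), true_and, Fin.ext_iff]
      simp only [Fin.val_zero, Fin.val_succ]
      omega
    · change (pathGraph (n + 2)).Adj a.succ 0 ↔ b = default ∧ a = 0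
      rw [pathGraph_adj, eq_true (Subsingleton.elim b default), true_and, Fin.ext_iff]
      simp only [Fin.val_zero, Fin.val_succ]
      omega
    · simp [pathGraph_adj]

/-- Edge joins respect isomorphisms of the second rooted graph. -/
def edgeJoinCongrRight {V₁ V₂ V₃ : Type*} (G₁ : SimpleGraph V₁) (v₁ : V₁) {G₂ : SimpleGraph V₂}
    {G₃ : SimpleGraph V₃} (φ : G₂ ≃g G₃) {v₂ : V₂} {v₃ : V₃} (h : φ v₂ = v₃) :
    edgeJoin G₁ v₁ G₂ v₂ ≃g edgeJoin G₁ v₁ G₃ v₃ where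
  toEquiv := (Equiv.refl V₁).sumCongr φ.toEquiv
  map_rel_iff' := by
    subst h
    rintro (a | a) (b | b)
    · simp
    · simp
    · simp
    · exact φ.map_adj_iff

theorem Connected.neighborSet_nonempty {V : Type*} [Nontrivial V] {G : SimpleGraph V}
    (hG : G.Connected) (v : V) : (G.neighborSet v).Nonempty :=
  hG.preconnected.exists_adj_of_nontrivial v

/-- A tree without vertices of degree at least three is a path from any vertex of degree at most
one. -/
theorem IsTree.exists_iso_pathGraph_of_ncard_le_two {n : ℕ} :
    ∀ {V : Type v} [Finite V] {T : SimpleGraph V}, T.IsTree → Nat.card V = n + 1 →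
      (∀ w, (T.neighborSet w).ncard ≤ 2) → ∀ {v : V}, (T.neighborSet v).ncard ≤ 1 →
        ∃ φ : T ≃g pathGraph (n + 1), φ v = 0 := by
  induction n with
  | zero =>
    intro V _ T hT hcard _ v _
    have : Subsingleton V := (Finite.card_le_one_iff_subsingleton.mp hcard.le)
    have : Unique V := ⟨⟨v⟩, fun a => Subsingleton.elim a v⟩
    refine ⟨⟨Equiv.ofUnique V (Fin 1), fun {a b} => ?_⟩, rfl⟩
    simp [Subsingleton.elim a b]
  | succ n ih =>
    intro V _ T hT hcard hdeg v hv
    have : Nontrivial V := Finite.one_lt_card_iff_nontrivial.mp (by omega)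
    obtain ⟨u, hu⟩ := hT.connected.neighborSet_nonempty v
    obtain ⟨V₁, V₂, T₁, T₂, v₁, v₂, φ, hT₁, hT₂, hφ⟩ := hT.exists_iso_edgeJoin hu
    have : Finite (V₁ ⊕ V₂) := Finite.of_equiv V φ.symm.toEquiv
    have : Finite V₁ := Finite.sum_left V₂
    have : Finite V₂ := Finite.sum_right V₁
    have hdeg₁ : (T₁.neighborSet v₁).ncard + 1 ≤ 1 := by
      rw [← ncard_neighborSet_edgeJoin_inl (G₂ := T₂) (v₂ := v₂), ← φ.ncard_neighborSet, hφ]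
      exact hv
    have : Subsingleton V₁ := by
      by_contra h
      rw [not_subsingleton_iff_nontrivial] at h
      have := (Set.ncard_pos (Set.toFinite _)).mpr (hT₁.connected.neighborSet_nonempty v₁)
      omega
    let _ : Unique V₁ := ⟨⟨v₁⟩, fun a => Subsingleton.elim a v₁⟩
    have hcard' : Nat.card V = Nat.card V₁ + Nat.card V₂ := by
      rw [← Nat.card_sum]
      exact Nat.card_congr φ.symm.toEquiv
    have hcard₁ : Nat.card V₁ = 1 := Nat.card_unique
    obtain ⟨ψ, hψ⟩ := ih hT₂ (by omega)
      (fun w => (ncard_neighborSet_le_edgeJoin_inr (G₁ := T₁) (v₁ := v₁) (v₂ := v₂) w).trans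
        (by rw [← φ.ncard_neighborSet]; exact hdeg _))
      (v := v₂) (by
        have := hdeg (φ (.inr v₂))
        rw [φ.ncard_neighborSet, ncard_neighborSet_edgeJoin_inr] at this
        omega)
    refine ⟨φ.symm.trans ((edgeJoinCongrRight T₁ v₁ ψ hψ).trans (pathGraphSuccIso T₁ n)), ?_⟩
    rw [← hφ]
    simp only [RelIso.trans_apply, RelIso.symm_apply_apply]
    rfl

theorem IsTree.exists_three_le_ncard_neighborSet {V : Type*} [Finite V] {T : SimpleGraph V}
    (hT : T.IsTree) {n : ℕ} (hn : Nat.card V = n) (hpath : ¬ Nonempty (T ≃g pathGraph n)) :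
    ∃ v, 3 ≤ (T.neighborSet v).ncard := by
  classical
  by_contra! hdeg
  have := hT.connected.nonempty
  obtain ⟨m, rfl⟩ : ∃ m, n = m + 1 := Nat.exists_eq_add_one.mpr (hn ▸ Nat.card_pos)
  have hleaf : ∃ v, (T.neighborSet v).ncard ≤ 1 := by
    rcases subsingleton_or_nontrivial V with h | h
    · obtain ⟨v⟩ := this
      exact ⟨v, (Set.ncard_le_one (Set.toFinite _)).mpr fun a _ b _ => Subsingleton.elim a b⟩
    · have := Fintype.ofFinite V
      obtain ⟨v, hv⟩ := hT.exists_vert_degree_one_of_nontrivial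
      refine ⟨v, ?_⟩
      rw [← hv, ← card_neighborSet_eq_degree, ← Nat.card_eq_fintype_card]
      rfl
  obtain ⟨v, hv⟩ := hleaf
  obtain ⟨φ, -⟩ := hT.exists_iso_pathGraph_of_ncard_le_two hn (fun w => by
    have := hdeg w
    omega) hv
  exact hpath ⟨φ⟩

end SimpleGraph

namespace TargetGraph

open Matrix SimpleGraph

/-! ### Counting colourings of rooted graphs -/

section Count

variable {W : Type u} (H : TargetGraph W)

theorem homCountAt_iso {V V' : Type*} {G : SimpleGraph V} {G' : SimpleGraph V'}
    (φ : G ≃g G') {v : V} {v' : V'} (h : φ v = v') : H.homCountAt G v = H.homCountAt G' v' := by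
  subst h
  funext x
  exact Nat.card_congr
    { toFun := fun f => ⟨f.1.comp φ.symm.toRelEmbedding.toRelHom,
        (congrArg f.1 (φ.symm_apply_apply v)).trans f.2⟩
      invFun := fun f => ⟨f.1.comp φ.toRelEmbedding.toRelHom, f.2⟩
      left_inv := fun f => Subtype.ext (RelHom.ext fun z => congrArg f.1 (φ.symm_apply_apply z))
      right_inv := fun f => Subtype.ext (RelHom.ext fun z => congrArg f.1 (φ.apply_symm_apply z)) }

theorem homCountAt_of_unique {V : Type*} [Unique V] (G : SimpleGraph V) (v : V) :
    H.homCountAt G v = 1 := by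
  funext x
  have : Unique {f : H.Coloring G // f v = x} :=
    { default := ⟨⟨fun _ => x, fun {a b} h => absurd (Subsingleton.elim a b) h.ne⟩, rfl⟩
      uniq := fun f => Subtype.ext (RelHom.ext fun z =>
        (congrArg f.1 (Subsingleton.elim z v)).trans f.2) }
  exact Nat.card_unique

/-- A colouring of an edge join is a pair of colourings whose values at the roots are adjacent. -/
def coloringEdgeJoinEquiv {V₁ V₂ : Type*} (G₁ : SimpleGraph V₁) (v₁ : V₁)
    (G₂ : SimpleGraph V₂) (v₂ : V₂) (x : W) :
    {f : H.Coloring (edgeJoin G₁ v₁ G₂ v₂) // f (.inl v₁) = x} ≃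
      {f : H.Coloring G₁ // f v₁ = x} × {g : H.Coloring G₂ // H.Adj x (g v₂)} where
  toFun f :=
    ⟨⟨⟨fun a => f.1 (.inl a), fun h => f.1.map_rel (edgeJoin_adj_inl_inl.mpr h)⟩, f.2⟩,
      ⟨⟨fun a => f.1 (.inr a), fun h => f.1.map_rel (edgeJoin_adj_inr_inr.mpr h)⟩, by
        have := f.1.map_rel
          (edgeJoin_adj_inl_inr (G₁ := G₁) (G₂ := G₂).mpr ⟨rfl, rfl⟩ :
            (edgeJoin G₁ v₁ G₂ v₂).Adj (.inl v₁) (.inr v₂))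
        rwa [f.2] at this⟩⟩
  invFun p := ⟨⟨Sum.elim p.1.1 p.2.1, by
    rintro (a | a) (b | b) h
    · exact p.1.1.map_rel h
    · obtain ⟨rfl, rfl⟩ := h
      simpa [p.1.2] using p.2.2
    · obtain ⟨rfl, rfl⟩ := h
      simpa [p.1.2] using H.symm _ _ p.2.2
    · exact p.2.1.map_rel h⟩, p.1.2⟩
  left_inv f := Subtype.ext (RelHom.ext fun z => by rcases z with z | z <;> rfl)
  right_inv _ := rfl

end Count

section Finite

variable {W : Type u} (H : TargetGraph W) [Fintype W]

theorem homCount_eq_sum_homCountAt {V : Type*} [Finite V] (G : SimpleGraph V) (v : V) :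
    H.homCount G = ∑ x, H.homCountAt G v x := by
  have : Finite (H.Coloring G) := DFunLike.finite _
  rw [homCount, Nat.card_congr (Equiv.sigmaFiberEquiv fun f : H.Coloring G => f v).symm,
    Nat.card_sigma]
  rfl

theorem card_coloring_adj {V : Type*} [Finite V] (G : SimpleGraph V) (v : V) (x : W) :
    Nat.card {g : H.Coloring G // H.Adj x (g v)} = (H.adjMat *ᵥ H.homCountAt G v) x := by
  classical
  have : Finite (H.Coloring G) := DFunLike.finite _
  rw [Nat.card_congr (Equiv.sigmaFiberEquiv
    fun g : {g : H.Coloring G // H.Adj x (g v)} => g.1 v).symm, Nat.card_sigma]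
  refine Finset.sum_congr rfl fun y _ => ?_
  change _ = H.adjMat x y * H.homCountAt G v y
  by_cases h : H.Adj x y
  · rw [H.adjMat_eq_one h, one_mul]
    exact Nat.card_congr
      { toFun := fun g => ⟨g.1.1, g.2⟩
        invFun := fun g => ⟨⟨g.1, g.2.symm ▸ h⟩, g.2⟩
        left_inv := fun _ => rfl
        right_inv := fun _ => rfl }
  · have : IsEmpty {g : {g : H.Coloring G // H.Adj x (g v)} // g.1 v = y} :=
      ⟨fun g => h (g.2 ▸ g.1.2)⟩
    simp [adjMat, h]

theorem homCountAt_edgeJoin {V₁ V₂ : Type*} [Finite V₂] (G₁ : SimpleGraph V₁) (v₁ : V₁)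
    (G₂ : SimpleGraph V₂) (v₂ : V₂) :
    H.homCountAt (edgeJoin G₁ v₁ G₂ v₂) (.inl v₁) =
      H.homCountAt G₁ v₁ * H.adjMat *ᵥ H.homCountAt G₂ v₂ := by
  funext x
  rw [homCountAt, Nat.card_congr (H.coloringEdgeJoinEquiv G₁ v₁ G₂ v₂ x), Nat.card_prod,
    card_coloring_adj]
  rfl

/-- Cutting an edge at the root of a tree. -/
theorem exists_homCountAt_eq_mul {V : Type v} [Finite V] {T : SimpleGraph V} (hT : T.IsTree) {v : V}
    (hv : (T.neighborSet v).Nonempty) :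
    ∃ (V₁ V₂ : Type v) (_ : Finite V₁) (_ : Finite V₂) (T₁ : SimpleGraph V₁)
      (T₂ : SimpleGraph V₂) (v₁ : V₁) (v₂ : V₂), T₁.IsTree ∧ T₂.IsTree ∧
      Nat.card V₁ + Nat.card V₂ = Nat.card V ∧
      (T₁.neighborSet v₁).ncard + 1 = (T.neighborSet v).ncard ∧
      H.homCountAt T v = H.homCountAt T₁ v₁ * H.adjMat *ᵥ H.homCountAt T₂ v₂ := by
  obtain ⟨u, hu⟩ := hv
  obtain ⟨V₁, V₂, T₁, T₂, v₁, v₂, φ, hT₁, hT₂, hφ⟩ := hT.exists_iso_edgeJoin hu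
  have : Finite (V₁ ⊕ V₂) := Finite.of_equiv V φ.symm.toEquiv
  have : Finite V₁ := Finite.sum_left V₂
  have : Finite V₂ := Finite.sum_right V₁
  refine ⟨V₁, V₂, ‹_›, ‹_›, T₁, T₂, v₁, v₂, hT₁, hT₂, ?_, ?_, ?_⟩
  · rw [← Nat.card_sum]
    exact Nat.card_congr φ.toEquiv
  · rw [← hφ, φ.ncard_neighborSet, ncard_neighborSet_edgeJoin_inl]
  · rw [← H.homCountAt_iso φ hφ, homCountAt_edgeJoin]

variable [DecidableEq W]

theorem homCountAt_pathGraph (n : ℕ) :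
    H.homCountAt (pathGraph (n + 1)) 0 = H.walkCount n := by
  induction n with
  | zero =>
    rw [walkCount_zero]
    exact H.homCountAt_of_unique (V := Fin 1) _ _
  | succ n ih =>
    rw [walkCount_succ, ← ih, ← H.homCountAt_iso
      (pathGraphSuccIso (⊥ : SimpleGraph Unit) n) (v := .inl default) (v' := 0) rfl,
      homCountAt_edgeJoin, homCountAt_of_unique, one_mul]

theorem homCount_pathGraph (n : ℕ) :
    H.homCount (pathGraph (n + 1)) = 1 ⬝ᵥ H.walkCount n := by
  rw [H.homCount_eq_sum_homCountAt _ 0, homCountAt_pathGraph, one_dotProduct]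

theorem adjMat_pow_pos_of_coloring {n : ℕ} (f : H.Coloring (pathGraph n)) (m : ℕ) (hm : m < n) :
    0 < (H.adjMat ^ m) (f ⟨0, by omega⟩) (f ⟨m, hm⟩) := by
  induction m with
  | zero => simp
  | succ m ih =>
    have hadj : H.Adj (f ⟨m, by omega⟩) (f ⟨m + 1, hm⟩) :=
      f.map_rel (pathGraph_adj.mpr (Or.inl rfl))
    rw [pow_succ, mul_apply]
    refine Finset.sum_pos' (fun _ _ => Nat.zero_le _) ⟨f ⟨m, by omega⟩, Finset.mem_univ _, ?_⟩
    rw [H.adjMat_eq_one hadj, mul_one]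
    exact ih _

/-! ### Trees versus paths -/

variable {H} {ι : Type*} [LinearOrder ι] {r : W → ι}

/-- If a branch beats the path of the same size as a rooted graph, it still does so after being
attached to the root by an edge: the symmetric adjacency matrix can be moved onto the weight of the
rest of the tree. -/
theorem dotProduct_walkCount_succ_le
    (hr : ∀ f, RankMonotone r f → RankMonotone r (H.adjMat *ᵥ f)) {n : ℕ} {h : W → ℕ}
    (hle : ∀ f : W → ℕ, RankMonotone r f → f ⬝ᵥ H.walkCount n ≤ f ⬝ᵥ h) {f : W → ℕ}
    (hf : RankMonotone r f) : f ⬝ᵥ H.walkCount (n + 1) ≤ f ⬝ᵥ (H.adjMat *ᵥ h) := by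
  rw [walkCount_succ, dotProduct_adjMat_mulVec, dotProduct_adjMat_mulVec]
  exact hle _ (hr f hf)

/-- A rooted tree, against any monotone weight at the root, has at least as many colourings as the
path of the same size rooted at an endvertex. -/
theorem walkCount_dotProduct_le_homCountAt
    (hr : ∀ f, RankMonotone r f → RankMonotone r (H.adjMat *ᵥ f)) (n : ℕ) :
    ∀ {V : Type v} [Finite V] {T : SimpleGraph V}, T.IsTree → Nat.card V = n + 1 → ∀ (v : V),
      RankMonotone r (H.homCountAt T v) ∧ ∀ f : W → ℕ, RankMonotone r f →
        f ⬝ᵥ H.walkCount n ≤ f ⬝ᵥ H.homCountAt T v := by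
  induction n using Nat.strong_induction_on with
  | _ n ih =>
    intro V _ T hT hcard v
    rcases (T.neighborSet v).eq_empty_or_nonempty with hv | hv
    · have : Subsingleton V := by
        by_contra h
        rw [not_subsingleton_iff_nontrivial] at h
        exact (hT.connected.neighborSet_nonempty v).ne_empty hv
      have : Unique V := ⟨⟨v⟩, fun a => Subsingleton.elim a v⟩
      obtain rfl : n = 0 := by
        rw [Nat.card_unique] at hcard
        omega
      rw [H.homCountAt_of_unique, walkCount_zero]
      exact ⟨RankMonotone.one r, fun _ _ => le_rfl⟩
    · obtain ⟨V₁, V₂, _, _, T₁, T₂, v₁, v₂, hT₁, hT₂, hsum, -, hcount⟩ :=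
        H.exists_homCountAt_eq_mul hT hv
      obtain ⟨m₁, h₁⟩ := Nat.exists_eq_add_one.mpr (Nat.card_pos_iff.mpr ⟨⟨v₁⟩, ‹Finite V₁›⟩)
      obtain ⟨m₂, h₂⟩ := Nat.exists_eq_add_one.mpr (Nat.card_pos_iff.mpr ⟨⟨v₂⟩, ‹Finite V₂›⟩)
      obtain rfl : n = m₁ + (m₂ + 1) := by omega
      obtain ⟨mono₁, le₁⟩ := ih m₁ (by omega) hT₁ h₁ v₁
      obtain ⟨mono₂, le₂⟩ := ih m₂ (by omega) hT₂ h₂ v₂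
      rw [hcount]
      refine ⟨mono₁.mul (hr _ mono₂), fun f hf => ?_⟩
      calc f ⬝ᵥ H.walkCount (m₁ + (m₂ + 1))
          ≤ f ⬝ᵥ (H.walkCount (m₂ + 1) * H.walkCount m₁) :=
            dotProduct_walkCount_add_le hr hf _ _
        _ = (f * H.walkCount (m₂ + 1)) ⬝ᵥ H.walkCount m₁ := by
            simp only [dotProduct, Pi.mul_apply, mul_assoc]
        _ ≤ (f * H.walkCount (m₂ + 1)) ⬝ᵥ H.homCountAt T₁ v₁ :=
            le₁ _ (hf.mul (rankMonotone_walkCount hr _))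
        _ = (f * H.homCountAt T₁ v₁) ⬝ᵥ H.walkCount (m₂ + 1) := by
            simp only [dotProduct, Pi.mul_apply, mul_assoc, mul_comm, mul_left_comm]
        _ ≤ (f * H.homCountAt T₁ v₁) ⬝ᵥ (H.adjMat *ᵥ H.homCountAt T₂ v₂) :=
            dotProduct_walkCount_succ_le hr le₂ (hf.mul mono₁)
        _ = f ⬝ᵥ (H.homCountAt T₁ v₁ * H.adjMat *ᵥ H.homCountAt T₂ v₂) := by
            simp only [dotProduct, Pi.mul_apply, mul_assoc]

/-- A tree with a vertex of degree at least three has strictly more colourings than the path of the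
same size: two of the branches at that vertex, and the rest of the tree, may be replaced by paths,
and merging two legs of the resulting spider is a strict step. -/
theorem homCount_pathGraph_lt
    (hr : ∀ f, RankMonotone r f → RankMonotone r (H.adjMat *ᵥ f))
    (hsep : ∀ m, 1 ≤ m → ∃ x y, 0 < (H.adjMat ^ m) x y ∧
      ∀ l, 1 ≤ l → H.walkCount l x < H.walkCount l y)
    {V : Type v} [Finite V] {T : SimpleGraph V} (hT : T.IsTree) {v : V}
    (hv : 3 ≤ (T.neighborSet v).ncard) :
    H.homCount (pathGraph (Nat.card V)) < H.homCount T := by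
  obtain ⟨V₁, V₂, _, _, T₁, T₂, v₁, v₂, hT₁, hT₂, hsum, hdeg, hcount⟩ :=
    H.exists_homCountAt_eq_mul hT
      (Set.nonempty_of_ncard_ne_zero (by omega : (T.neighborSet v).ncard ≠ 0))
  obtain ⟨V₃, V₄, _, _, T₃, T₄, v₃, v₄, hT₃, hT₄, hsum', hdeg', hcount'⟩ :=
    H.exists_homCountAt_eq_mul hT₁
      (Set.nonempty_of_ncard_ne_zero (by omega : (T₁.neighborSet v₁).ncard ≠ 0))
  obtain ⟨b, hb⟩ := Nat.exists_eq_add_one.mpr (Nat.card_pos_iff.mpr ⟨⟨v₂⟩, ‹Finite V₂›⟩)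
  obtain ⟨a, ha⟩ := Nat.exists_eq_add_one.mpr (Nat.card_pos_iff.mpr ⟨⟨v₄⟩, ‹Finite V₄›⟩)
  obtain ⟨m, hm⟩ := Nat.exists_eq_add_one.mpr (Nat.card_pos_iff.mpr ⟨⟨v₃⟩, ‹Finite V₃›⟩)
  -- The part of the tree that keeps the root still has an edge at the root.
  have hm1 : 1 ≤ m := by
    have := Set.ncard_lt_card (s := T₃.neighborSet v₃)
      (fun h => T₃.loopless.irrefl v₃ (h ▸ Set.mem_univ v₃ : v₃ ∈ T₃.neighborSet v₃))
    omega
  obtain ⟨mono₁, -⟩ := walkCount_dotProduct_le_homCountAt hr (m + a + 1) hT₁ (by omega) v₁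
  obtain ⟨mono₃, le₃⟩ := walkCount_dotProduct_le_homCountAt hr m hT₃ hm v₃
  obtain ⟨-, le₄⟩ := walkCount_dotProduct_le_homCountAt hr a hT₄ ha v₄
  obtain ⟨-, le₂⟩ := walkCount_dotProduct_le_homCountAt hr b hT₂ hb v₂
  obtain ⟨x, y, hxy, hlt⟩ := hsep m hm1
  have mono (n : ℕ) := rankMonotone_walkCount hr n
  rw [show Nat.card V = (m + (b + 1)) + (a + 1) + 1 by omega, homCount_pathGraph,
    H.homCount_eq_sum_homCountAt T v, ← one_dotProduct, hcount]
  calc 1 ⬝ᵥ H.walkCount (m + (b + 1) + (a + 1))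
      ≤ 1 ⬝ᵥ (H.walkCount (a + 1) * H.walkCount (m + (b + 1))) :=
        dotProduct_walkCount_add_le hr (RankMonotone.one r) _ _
    _ = H.walkCount (a + 1) ⬝ᵥ (H.adjMat ^ m *ᵥ H.walkCount (b + 1)) := by
        rw [← H.walkCount_add m (b + 1)]
        simp only [dotProduct, Pi.mul_apply, Pi.one_apply, one_mul]
    _ < H.walkCount (a + 1) ⬝ᵥ (H.walkCount (b + 1) * H.walkCount m) :=
        dotProduct_mulVec_lt (H.adjMat_isSymm.pow m) (mono _) (mono _) hxy
          (hlt _ (Nat.le_add_left 1 a)) (hlt _ (Nat.le_add_left 1 b))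
    _ = (H.walkCount (a + 1) * H.walkCount (b + 1)) ⬝ᵥ H.walkCount m := by
        simp only [dotProduct, Pi.mul_apply, mul_assoc]
    _ ≤ (H.walkCount (a + 1) * H.walkCount (b + 1)) ⬝ᵥ H.homCountAt T₃ v₃ :=
        le₃ _ ((mono _).mul (mono _))
    _ = (H.homCountAt T₃ v₃ * H.walkCount (b + 1)) ⬝ᵥ H.walkCount (a + 1) := by
        simp only [dotProduct, Pi.mul_apply, mul_assoc, mul_comm]
    _ ≤ (H.homCountAt T₃ v₃ * H.walkCount (b + 1)) ⬝ᵥ (H.adjMat *ᵥ H.homCountAt T₄ v₄) :=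
        dotProduct_walkCount_succ_le hr le₄ (mono₃.mul (mono _))
    _ = H.homCountAt T₁ v₁ ⬝ᵥ H.walkCount (b + 1) := by
        rw [hcount']
        simp only [dotProduct, Pi.mul_apply]
        exact Finset.sum_congr rfl fun x _ => by ring
    _ ≤ H.homCountAt T₁ v₁ ⬝ᵥ (H.adjMat *ᵥ H.homCountAt T₂ v₂) :=
        dotProduct_walkCount_succ_le hr le₂ mono₁
    _ = 1 ⬝ᵥ (H.homCountAt T₁ v₁ * H.adjMat *ᵥ H.homCountAt T₂ v₂) := by
        simp only [dotProduct, Pi.mul_apply, Pi.one_apply, one_mul]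

end Finite

end TargetGraph

theorem corollary1p5 {W : Type u} [Finite W] (H : TargetGraph W)
    (hM : ∃ (k : ℕ) (e : Fin k ≃ H.SimClass), HasIncreasingColumns (H.simMatrix e))
    (hab : ∀ (t : ℕ) (ht : 2 ≤ t), ∃ a b : H.SimClass,
      (∃ f : H.Coloring (SimpleGraph.pathGraph t),
        H.simClass (f (pathFirst t ht)) = a ∧ H.simClass (f (pathLast t ht)) = b) ∧
      ∀ (s : ℕ) (hs : 2 ≤ s),
        H.homCountClass (SimpleGraph.pathGraph s) (pathFirst s hs) a <
          H.homCountClass (SimpleGraph.pathGraph s) (pathFirst s hs) b) :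
    H.StronglyHoffmanLondon := by
  classical
  have := Fintype.ofFinite W
  obtain ⟨k, e, he⟩ := hM
  intro n _ T hT hpath
  obtain ⟨v, hv⟩ := hT.exists_three_le_ncard_neighborSet (Nat.card_fin n) hpath
  have hlt := TargetGraph.homCount_pathGraph_lt
    (fun f hf => H.rankMonotone_adjMat_mulVec he hf) (fun m hm => ?_) hT hv
  · rwa [Nat.card_fin] at hlt
  -- The path on `t` vertices corresponds to walks of length `m = t - 1`.
  · obtain ⟨_, _, ⟨f, rfl, rfl⟩, hlt⟩ := hab (m + 1) (by omega)
    refine ⟨_, _, H.adjMat_pow_pos_of_coloring f m (by omega), fun l hl => ?_⟩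
    have := hlt (l + 1) (by omega)
    rw [← H.homCountAt_pathGraph l]
    exact this
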